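/- Let $\mathcal H$ be a complex Hilbert space of finite dimension $d\ge 2$, let $L_1,\dots,L_m$ be linear operators on $\mathcal H$, and let $$\mathcal D=\sum_{j=1}^m\mathcal D_{L_j},\qquad \mathcal D_L(X)=LXL^\dagger-\tfrac12\left(L^\dagger L X+XL^\dagger L\right).$$ A drive is a map $t\mapsto H(t)$ into the operators on $\mathcal H$ that is self-adjoint for every $t\ge 0$ and has locally integrable components on $[0,\infty)$. It defines the driven Lindbladian $\mathcal L_t=-i[H(t),\,\cdot\,]+\mathcal D$ and, for $t\ge s\ge0$, the time-evolution channel $\mathcal E_{t,s}=\mathcal T\exp\left(\int_s^t\mathcal L_\tau\,d\tau\right)$, the time-ordered exponential given by the Dyson series $\sum_{n\ge0}\int_{s\le\tau_1\le\dots\le\tau_n\le t}\mathcal L_{\tau_n}\cdots\mathcal L_{\tau_1}\,d\tau_1\cdots d\tau_n$. For $K,\gamma>0$ say that $\mathcal L_t$ contracts with constants $(K,\gamma)$ if $$\|\mathcal E_{t,s}(\rho-\sigma)\|_1\le K e^{-\gamma|t-s|}\,\|\rho-\sigma\|_1$$ for all states $\rho,\sigma$ (positive semidefinite operators of trace $1$)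 and all $t\ge s\ge0$, where $\|\cdot\|_1$ is the trace norm. $\mathcal L_t$ is exponentially contractive if it contracts with some constants $K,\gamma>0$; its contraction rate is the supremum of all $\gamma>0$ that occur in such a pair. $\mathcal D$ is Hamiltonian-independently contractive if $\mathcal L_t$ is exponentially contractive for every drive $H$. Define $$R(\mathcal D)=\min_{\substack{\|u\|=\|v\|=1\\ \langle u|v\rangle=0}}\ \sum_{j}\left(|\langle v|L_j|u\rangle|^2+|\langle v|L_j^\dagger|u\rangle|^2\right),\qquad r(\mathcal D)=\min_{\substack{\|u\|=\|v\|=1\\ \langle u|v\rangle=0}}\ \sum_{j}|\langle v|L_j|u\rangle|^2 .$$ Both minima are attained, and: 1. If $R(\mathcal D)>0$, then $\mathcal D$ is Hamiltonian-independently contractive, and for every drive $H$ the contraction rate of $\mathcal L_t$ is at least $R(\mathcal D)$; moreover $\mathcal L_t$ contracts with constants $K=1$ and $\gamma=R(\mathcal D)$. 2. If $r(\mathcal D)>0$, then $\mathcal D$ is Hamiltonian-independently contractive, and for every drive $H$ the contraction rate of $\mathcal L_t$ is at least $d\,r(\mathcal D)$; moreover $\mathcal L_t$ contracts with constants $K=1$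 and $\gamma=d\,r(\mathcal D)$. -/

import Mathlib

noncomputable section

namespace DrivenLindblad

/-- The operators `B(𝓗)`; multiplication is composition, the norm is the operator norm. -/
abbrev Op (𝓗 : Type*) [NormedAddCommGroup 𝓗] [InnerProductSpace ℂ 𝓗] : Type _ := 𝓗 →L[ℂ] 𝓗

/-- Super-operators, i.e. linear maps `B(𝓗) → B(𝓗)`. -/
abbrev SuperOp (𝓗 : Type*) [NormedAddCommGroup 𝓗] [InnerProductSpace ℂ 𝓗] : Type _ :=
  Op 𝓗 →L[ℂ] Op 𝓗

section

variable {𝓗 : Type*} [NormedAddCommGroup 𝓗] [InnerProductSpace ℂ 𝓗]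

/-- The quantum states: positive semidefinite operators of trace one. -/
def states (𝓗 : Type*) [NormedAddCommGroup 𝓗] [InnerProductSpace ℂ 𝓗] : Set (Op 𝓗) :=
  {ρ | ρ.IsPositive ∧ LinearMap.trace ℂ 𝓗 ρ.toLinearMap = 1}

/-- The trace norm (Schatten `1`-norm): the sum of the singular values. -/
def traceNorm [FiniteDimensional ℂ 𝓗] (A : Op 𝓗) : ℝ :=
  ∑ i ∈ Finset.range (Module.finrank ℂ 𝓗), A.toLinearMap.singularValues i

/-- The super-operator `X ↦ -i [H, X]`. -/
def hamiltonianPart (H : Op 𝓗) : SuperOp 𝓗 :=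
  (-Complex.I) • (ContinuousLinearMap.mulLeftRight ℂ (Op 𝓗) H 1
    - ContinuousLinearMap.mulLeftRight ℂ (Op 𝓗) 1 H)

/-- The dissipator `X ↦ L X L† - {L† L, X} / 2` of one jump operator. -/
def jumpDissipator [CompleteSpace 𝓗] (L : Op 𝓗) : SuperOp 𝓗 :=
  ContinuousLinearMap.mulLeftRight ℂ (Op 𝓗) L (ContinuousLinearMap.adjoint L)
    - (1 / 2 : ℂ) •
      (ContinuousLinearMap.mulLeftRight ℂ (Op 𝓗) (ContinuousLinearMap.adjoint L * L) 1
        + ContinuousLinearMap.mulLeftRight ℂ (Op 𝓗) 1 (ContinuousLinearMap.adjoint L * L))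

theorem hamiltonianPart_apply (H X : Op 𝓗) :
    hamiltonianPart H X = (-Complex.I) • (H * X - X * H) := by
  simp [hamiltonianPart]

theorem jumpDissipator_apply [CompleteSpace 𝓗] (L X : Op 𝓗) :
    jumpDissipator L X = L * X * ContinuousLinearMap.adjoint L
      - (1 / 2 : ℂ) • (ContinuousLinearMap.adjoint L * L * X
        + X * (ContinuousLinearMap.adjoint L * L)) := by
  simp [jumpDissipator]

/-- The dissipator `𝓓 = ∑ⱼ 𝓓_{Lⱼ}` of a finite family of jump operators. -/
def dissipator [CompleteSpace 𝓗] {m : ℕ} (L : Fin m → Op 𝓗) : SuperOp 𝓗 :=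
  ∑ j, jumpDissipator (L j)

/-- The driven Lindbladian `𝓛_t = -i [H(t), ·] + ∑ⱼ 𝓓_{Lⱼ}`. -/
def lindbladian [CompleteSpace 𝓗] {m : ℕ} (H : ℝ → Op 𝓗) (L : Fin m → Op 𝓗) (t : ℝ) :
    SuperOp 𝓗 :=
  hamiltonianPart (H t) + dissipator L

/-- The Hamiltonians allowed as drives: self-adjoint at all times `t ≥ 0` and locally integrable
on `[0, ∞)` (in finite dimension: with locally integrable components). -/
def IsDrive [CompleteSpace 𝓗] (H : ℝ → Op 𝓗) : Prop :=
  (∀ t, 0 ≤ t → IsSelfAdjoint (H t)) ∧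
    MeasureTheory.LocallyIntegrableOn H (Set.Ici 0) MeasureTheory.volume

/-- The `n`-th term of the Dyson series started at time `s`,
`∫_{s ≤ τ₁ ≤ ⋯ ≤ τₙ ≤ t} 𝓛_{τₙ} ⋯ 𝓛_{τ₁} dτ₁ ⋯ dτₙ`, for a time-dependent generator `𝓛` on a
normed space `E`. -/
def dysonTerm {E : Type*} [NormedAddCommGroup E] [NormedSpace ℂ E] (𝓛 : ℝ → E →L[ℂ] E) (s : ℝ) :
    ℕ → ℝ → E →L[ℂ] E
  | 0, _ => ContinuousLinearMap.id ℂ E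
  | n + 1, t => ∫ τ in s..t, (𝓛 τ).comp (dysonTerm 𝓛 s n τ)

/-- The time-ordered exponential `𝓣 exp (∫_s^t 𝓛_τ dτ)`, given by its Dyson series. For `𝓛` a
driven Lindbladian and `E = B(𝓗)`, this is the time-evolution channel `𝓔_{t,s}`. -/
def evolution {E : Type*} [NormedAddCommGroup E] [NormedSpace ℂ E] (𝓛 : ℝ → E →L[ℂ] E)
    (t s : ℝ) : E →L[ℂ] E :=
  ∑' n, dysonTerm 𝓛 s n t

/-- `‖𝓔_{t,s}(ρ - σ)‖₁ ≤ K e^{-γ |t - s|} ‖ρ - σ‖₁` for all states `ρ`, `σ` and `t ≥ s ≥ 0`. -/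
def ContractsWith [FiniteDimensional ℂ 𝓗] (𝓛 : ℝ → SuperOp 𝓗) (K γ : ℝ) : Prop :=
  ∀ ρ ∈ states 𝓗, ∀ σ ∈ states 𝓗, ∀ s t : ℝ, 0 ≤ s → s ≤ t →
    traceNorm (evolution 𝓛 t s (ρ - σ)) ≤ K * Real.exp (-γ * |t - s|) * traceNorm (ρ - σ)

/-- Exponential contractivity of a time-dependent Lindbladian. -/
def IsExponentiallyContractive [FiniteDimensional ℂ 𝓗] (𝓛 : ℝ → SuperOp 𝓗) : Prop :=
  ∃ K γ : ℝ, 0 < K ∧ 0 < γ ∧ ContractsWith 𝓛 K γ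

/-- The contraction rate: the supremum of all `γ > 0` that are admissible in the definition of
exponential contractivity. -/
def contractionRate [FiniteDimensional ℂ 𝓗] (𝓛 : ℝ → SuperOp 𝓗) : EReal :=
  sSup {x | ∃ K γ : ℝ, 0 < K ∧ 0 < γ ∧ ContractsWith 𝓛 K γ ∧ x = (γ : EReal)}

/-- The dissipator with jump operators `L` is Hamiltonian-independently contractive. -/
def IsHamiltonianIndependentlyContractive [FiniteDimensional ℂ 𝓗] [CompleteSpace 𝓗] {m : ℕ}
    (L : Fin m → Op 𝓗) : Prop :=
  ∀ H : ℝ → Op 𝓗, IsDrive H → IsExponentiallyContractive (lindbladian H L)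

/-- The values of `∑ⱼ (|⟨v|Lⱼ|u⟩|² + |⟨v|Lⱼ†|u⟩|²)` over all orthonormal pairs `u, v`. -/
def bigRValues [CompleteSpace 𝓗] {m : ℕ} (L : Fin m → Op 𝓗) : Set ℝ :=
  {x | ∃ u v : 𝓗, ‖u‖ = 1 ∧ ‖v‖ = 1 ∧ inner ℂ u v = 0 ∧
    x = ∑ j, (‖inner ℂ v (L j u)‖ ^ 2
      + ‖inner ℂ v (ContinuousLinearMap.adjoint (L j) u)‖ ^ 2)}

/-- The values of `∑ⱼ |⟨v|Lⱼ|u⟩|²` over all orthonormal pairs `u, v`. -/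
def smallRValues {m : ℕ} (L : Fin m → Op 𝓗) : Set ℝ :=
  {x | ∃ u v : 𝓗, ‖u‖ = 1 ∧ ‖v‖ = 1 ∧ inner ℂ u v = 0 ∧
    x = ∑ j, ‖inner ℂ v (L j u)‖ ^ 2}

/-- The quantity `R(𝓓)`: the minimum of `bigRValues L`. -/
def bigR [CompleteSpace 𝓗] {m : ℕ} (L : Fin m → Op 𝓗) : ℝ := sInf (bigRValues L)

/-- The quantity `r(𝓓)`: the minimum of `smallRValues L`. -/
def smallR {m : ℕ} (L : Fin m → Op 𝓗) : ℝ := sInf (smallRValues L)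

end

end DrivenLindblad

end

open DrivenLindblad

/-! ### Dyson series and the integral equation for integrable generators. -/

noncomputable section

open MeasureTheory Set
open scoped Nat

/-! For states `ρ`, `σ` the orbit `X` of `ρ - σ` stays traceless and self-adjoint
(`map_evolution_eq_zero`). Expand it, at one time, in an eigenbasis `b` with eigenvalues `l`. The
diagonal of the generator in `b` does not see the Hamiltonian, whose commutator vanishes there, and
the dissipator acts on `l` as a classical rate equation with jump rates `∑ j, |⟨b i|L j|b k⟩|²` from
`k` to `i` (`re_inner_lindbladian`). So the decay of `∑ |l i|`, the trace norm, is a question about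
real numbers: `flux_le_of_le` uses a lower bound `r` on each rate, `flux_le_of_le_add` a lower bound
`R` on the two rates of each pair together.

The drive is merely integrable and eigenvectors need not vary differentiably. Hence the trace norm
along the orbit is shown to be absolutely continuous and is differentiated almost everywhere, by
comparison with the linear functional given by the signs of `l`, which touches it from below
(`contractsWith_of_weightedDiagonal_le`). -/

/-- A function whose increments are dominated by those of an absolutely continuous function is
absolutely continuous. -/
theorem AbsolutelyContinuousOnInterval.of_dist_le {X Y : Type*} [PseudoMetricSpace X]
    [PseudoMetricSpace Y] {f : ℝ → X} {g : ℝ → Y} {a b : ℝ}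
    (hg : AbsolutelyContinuousOnInterval g a b)
    (h : ∀ x ∈ uIcc a b, ∀ y ∈ uIcc a b, dist (f x) (f y) ≤ dist (g x) (g y)) :
    AbsolutelyContinuousOnInterval f a b := by
  rw [absolutelyContinuousOnInterval_iff] at hg ⊢
  intro ε hε
  obtain ⟨δ, hδ, H⟩ := hg ε hε
  refine ⟨δ, hδ, fun E hE hlt => lt_of_le_of_lt (Finset.sum_le_sum fun i hi => ?_) (H E hE hlt)⟩
  exact h _ (hE.1 i hi).1 _ (hE.1 i hi).2

/-- The powers of a primitive: `∫_a^b g Gⁿ / n! = Gⁿ⁺¹ / (n + 1)!`, where `G = ∫_a g`. -/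
theorem integral_mul_primitive_pow {g : ℝ → ℝ} {a b : ℝ} (hg : IntervalIntegrable g volume a b)
    (n : ℕ) :
    ∫ t in a..b, g t * ((∫ v in a..t, g v) ^ n / n !) = (∫ v in a..b, g v) ^ (n + 1) / (n + 1)! := by
  set G : ℝ → ℝ := fun t => ∫ v in a..t, g v with hG
  -- Since `g` is only integrable, `G' = g` holds only almost everywhere; absolute continuity still
  -- gives the fundamental theorem.
  have hac : AbsolutelyContinuousOnInterval G a b :=
    hg.absolutelyContinuousOnInterval_intervalIntegral left_mem_uIcc
  have hpow : ∀ k : ℕ, AbsolutelyContinuousOnInterval (fun t => G t ^ k) a b := by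
    intro k
    induction k with
    | zero =>
      simp only [pow_zero]
      exact (LipschitzWith.const (1 : ℝ)).lipschitzOnWith.absolutelyContinuousOnInterval
    | succ k ih => simpa only [pow_succ] using ih.fun_mul hac
  have hF := (hpow (n + 1)).const_mul (((n + 1)! : ℝ)⁻¹)
  have hFTC := hF.integral_deriv_eq_sub
  have h0 : G a = 0 := by simp [hG]
  rw [h0, zero_pow n.succ_ne_zero, mul_zero, sub_zero, inv_mul_eq_div] at hFTC
  rw [← hFTC]
  apply intervalIntegral.integral_congr_ae
  filter_upwards [hg.ae_hasDerivAt_integral] with t ht hmem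
  have hd : HasDerivAt G (g t) t := ht (uIoc_subset_uIcc hmem) a left_mem_uIcc
  have := ((hd.pow (n + 1)).const_mul (((n + 1)! : ℝ)⁻¹)).deriv
  simp only [Pi.pow_apply] at this
  rw [this, Nat.factorial_succ]
  push_cast
  field_simp
  simp [hG]

namespace DrivenLindblad

section Dyson

variable {E : Type*} [NormedAddCommGroup E] [NormedSpace ℂ E] {𝓛 : ℝ → E →L[ℂ] E} {s T : ℝ}

theorem intervalIntegrable_comp_of_continuousOn {F : ℝ → E →L[ℂ] E} {a b : ℝ}
    (h𝓛 : IntervalIntegrable 𝓛 volume a b) (hF : ContinuousOn F (uIcc a b)) :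
    IntervalIntegrable (fun τ => (𝓛 τ).comp (F τ)) volume a b :=
  h𝓛.mul_continuousOn hF

theorem intervalIntegrable_of_mem_Icc {F : Type*} [NormedAddCommGroup F] {f : ℝ → F} {t u : ℝ}
    (hf : IntervalIntegrable f volume s T) (ht : t ∈ Icc s T) (hu : u ∈ Icc s T) :
    IntervalIntegrable f volume t u :=
  hf.mono_set ((uIcc_subset_Icc ht hu).trans Icc_subset_uIcc)

theorem continuousOn_dysonTerm (hsT : s ≤ T) (h𝓛 : IntervalIntegrable 𝓛 volume s T) (n : ℕ) :
    ContinuousOn (dysonTerm 𝓛 s n) (Icc s T) := by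
  induction n with
  | zero => exact continuousOn_const
  | succ n ih =>
    rw [← uIcc_of_le hsT] at ih ⊢
    exact intervalIntegral.continuousOn_primitive_interval'
      (intervalIntegrable_comp_of_continuousOn h𝓛 ih) left_mem_uIcc

theorem norm_dysonTerm_le (hsT : s ≤ T) (h𝓛 : IntervalIntegrable 𝓛 volume s T) (n : ℕ) {t : ℝ}
    (ht : t ∈ Icc s T) : ‖dysonTerm 𝓛 s n t‖ ≤ (∫ τ in s..t, ‖𝓛 τ‖) ^ n / n ! := by
  have hs : s ∈ Icc s T := left_mem_Icc.2 hsT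
  induction n generalizing t with
  | zero => simpa [dysonTerm] using ContinuousLinearMap.norm_id_le (𝕜 := ℂ) (E := E)
  | succ n ih =>
    have hint := intervalIntegrable_of_mem_Icc h𝓛.norm hs ht
    rw [← integral_mul_primitive_pow hint n]
    refine intervalIntegral.norm_integral_le_of_norm_le ht.1 (.of_forall fun τ hτ => ?_) ?_
    · refine (ContinuousLinearMap.opNorm_comp_le _ _).trans ?_
      gcongr
      exact ih ⟨hτ.1.le, hτ.2.trans ht.2⟩
    · refine hint.mul_continuousOn (ContinuousOn.div_const (ContinuousOn.pow ?_ n) _)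
      exact intervalIntegral.continuousOn_primitive_interval' hint left_mem_uIcc

theorem norm_dysonTerm_le_of_le (hsT : s ≤ T) (h𝓛 : IntervalIntegrable 𝓛 volume s T) (n : ℕ)
    {t : ℝ} (ht : t ∈ Icc s T) : ‖dysonTerm 𝓛 s n t‖ ≤ (∫ τ in s..T, ‖𝓛 τ‖) ^ n / n ! := by
  refine (norm_dysonTerm_le hsT h𝓛 n ht).trans ?_
  gcongr
  · exact intervalIntegral.integral_nonneg ht.1 fun _ _ => norm_nonneg _
  · exact intervalIntegral.integral_mono_interval le_rfl ht.1 ht.2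
      (.of_forall fun _ => norm_nonneg _) h𝓛.norm

variable [CompleteSpace E]

theorem hasSum_dysonTerm (hsT : s ≤ T) (h𝓛 : IntervalIntegrable 𝓛 volume s T) {t : ℝ}
    (ht : t ∈ Icc s T) : HasSum (fun n => dysonTerm 𝓛 s n t) (evolution 𝓛 t s) :=
  (Summable.of_norm_bounded (Real.summable_pow_div_factorial _) fun n =>
    norm_dysonTerm_le_of_le hsT h𝓛 n ht).hasSum

theorem continuousOn_evolution (hsT : s ≤ T) (h𝓛 : IntervalIntegrable 𝓛 volume s T) :
    ContinuousOn (fun t => evolution 𝓛 t s) (Icc s T) :=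
  continuousOn_tsum (continuousOn_dysonTerm hsT h𝓛) (Real.summable_pow_div_factorial _)
    fun n _ ht => norm_dysonTerm_le_of_le hsT h𝓛 n ht

/-- Integrating the series term by term, by dominated convergence, shifts it by one; the missing
zeroth term is the identity. -/
theorem evolution_eq_id_add_integral (hsT : s ≤ T) (h𝓛 : IntervalIntegrable 𝓛 volume s T) :
    evolution 𝓛 T s
      = ContinuousLinearMap.id ℂ E + ∫ τ in s..T, (𝓛 τ).comp (evolution 𝓛 τ s) := by
  have hT : T ∈ Icc s T := right_mem_Icc.2 hsT
  have hsum := hasSum_dysonTerm hsT h𝓛 hT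
  have hsub : uIoc s T ⊆ Icc s T := by rw [uIoc_of_le hsT]; exact Ioc_subset_Icc_self
  have key : HasSum (fun n => ∫ τ in s..T, (𝓛 τ).comp (dysonTerm 𝓛 s n τ))
      (∫ τ in s..T, (𝓛 τ).comp (evolution 𝓛 τ s)) := by
    refine intervalIntegral.hasSum_integral_of_dominated_convergence
      (fun n τ => ‖𝓛 τ‖ * ((∫ τ in s..T, ‖𝓛 τ‖) ^ n / n !)) (fun n => ?_) (fun n => ?_) ?_ ?_ ?_
    · exact IntervalIntegrable.aestronglyMeasurable_restrict_uIoc <|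
        intervalIntegrable_comp_of_continuousOn h𝓛
          (by rw [uIcc_of_le hsT]; exact continuousOn_dysonTerm hsT h𝓛 n)
    · refine .of_forall fun τ hτ => (ContinuousLinearMap.opNorm_comp_le _ _).trans ?_
      gcongr
      exact norm_dysonTerm_le_of_le hsT h𝓛 n (hsub hτ)
    · exact .of_forall fun τ _ => (Real.summable_pow_div_factorial _).mul_left _
    · simp only [tsum_mul_left]
      exact h𝓛.norm.mul_const _
    · refine .of_forall fun τ hτ => ?_
      exact (hasSum_dysonTerm hsT h𝓛 (hsub hτ)).mul_left (𝓛 τ)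
  exact hsum.unique ((hasSum_nat_add_iff' 1).1 (by simpa [dysonTerm] using key))

theorem evolution_self (s : ℝ) : evolution 𝓛 s s = ContinuousLinearMap.id ℂ E := by
  simpa using evolution_eq_id_add_integral (𝓛 := 𝓛) le_rfl IntervalIntegrable.refl

/-- The orbits of the evolution solve the integral equation. -/
theorem evolution_apply_eq (hsT : s ≤ T) (h𝓛 : IntervalIntegrable 𝓛 volume s T) (x : E) :
    evolution 𝓛 T s x = x + ∫ τ in s..T, 𝓛 τ (evolution 𝓛 τ s x) := by
  have hint := intervalIntegrable_comp_of_continuousOn h𝓛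
    (by rw [uIcc_of_le hsT]; exact continuousOn_evolution hsT h𝓛)
  have := congrArg (fun A : E →L[ℂ] E => A x) (evolution_eq_id_add_integral hsT h𝓛)
  simpa [ContinuousLinearMap.intervalIntegral_apply hint] using this

theorem intervalIntegrable_evolution_apply (hsT : s ≤ T) (h𝓛 : IntervalIntegrable 𝓛 volume s T)
    (x : E) : IntervalIntegrable (fun τ => 𝓛 τ (evolution 𝓛 τ s x)) volume s T := by
  have hint := intervalIntegrable_comp_of_continuousOn h𝓛
    (by rw [uIcc_of_le hsT]; exact continuousOn_evolution hsT h𝓛)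
  exact ⟨hint.1.apply_continuousLinearMap x, hint.2.apply_continuousLinearMap x⟩

/-- Linear constraints that are preserved by the generator are preserved by the evolution. -/
theorem map_evolution_eq_zero {G : Type*} [NormedAddCommGroup G] [NormedSpace ℝ G]
    [CompleteSpace G] (ℓ : E →L[ℝ] G) (hsT : s ≤ T) (h𝓛 : IntervalIntegrable 𝓛 volume s T)
    (hℓ : ∀ τ ∈ Icc s T, ∀ x, ℓ x = 0 → ℓ (𝓛 τ x) = 0) {x : E} (hx : ℓ x = 0) :
    ℓ (evolution 𝓛 T s x) = 0 := by
  have hterm : ∀ n, ∀ t ∈ Icc s T, ℓ (dysonTerm 𝓛 s n t x) = 0 := by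
    intro n
    induction n with
    | zero => intro t _; simpa [dysonTerm] using hx
    | succ n ih =>
      intro t ht
      have hs : s ∈ Icc s T := left_mem_Icc.2 hsT
      have hint : IntervalIntegrable (fun τ => (𝓛 τ).comp (dysonTerm 𝓛 s n τ)) volume s t :=
        intervalIntegrable_of_mem_Icc (intervalIntegrable_comp_of_continuousOn h𝓛
          (by rw [uIcc_of_le hsT]; exact continuousOn_dysonTerm hsT h𝓛 n)) hs ht
      have hint' : IntervalIntegrable (fun τ => (𝓛 τ).comp (dysonTerm 𝓛 s n τ) x) volume s t :=
        ⟨hint.1.apply_continuousLinearMap x, hint.2.apply_continuousLinearMap x⟩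
      rw [dysonTerm, ContinuousLinearMap.intervalIntegral_apply hint,
        ← ContinuousLinearMap.intervalIntegral_comp_comm ℓ hint',
        intervalIntegral.integral_congr (g := fun _ => 0), intervalIntegral.integral_zero]
      intro τ hτ
      rw [uIcc_of_le ht.1] at hτ
      have hτ' : τ ∈ Icc s T := ⟨hτ.1, hτ.2.trans ht.2⟩
      exact hℓ τ hτ' _ (ih τ hτ')
  have hT : T ∈ Icc s T := right_mem_Icc.2 hsT
  have h1 : HasSum (fun n => ℓ (dysonTerm 𝓛 s n T x)) (ℓ (evolution 𝓛 T s x)) :=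
    ((hasSum_dysonTerm hsT h𝓛 hT).mapL (ContinuousLinearMap.apply ℂ E x)).mapL ℓ
  exact h1.unique (by simpa only [hterm _ T hT] using hasSum_zero)

end Dyson

end DrivenLindblad

end

noncomputable section

namespace DrivenLindblad

/-! ### Trace norm and eigenbases of self-adjoint operators. -/

section Spectral

variable {𝓗 : Type*} [NormedAddCommGroup 𝓗] [InnerProductSpace ℂ 𝓗]

/-- The real linear functional `B ↦ ∑ᵢ cᵢ Re ⟨bᵢ|B|bᵢ⟩`. -/
def weightedDiagonal {ι : Type*} [Fintype ι] (b : OrthonormalBasis ι ℂ 𝓗) (c : ι → ℝ) :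
    Op 𝓗 →L[ℝ] ℝ :=
  ∑ i, c i • (Complex.reCLM ∘L (innerSL ℂ (b i)).restrictScalars ℝ ∘L
    (ContinuousLinearMap.apply ℂ 𝓗 (b i)).restrictScalars ℝ)

theorem weightedDiagonal_apply {ι : Type*} [Fintype ι] (b : OrthonormalBasis ι ℂ 𝓗) (c : ι → ℝ)
    (B : Op 𝓗) : weightedDiagonal b c B = ∑ i, c i * (inner ℂ (b i) (B (b i))).re := by
  simp [weightedDiagonal]

variable {ι κ : Type*} [Fintype ι] [Fintype κ]

theorem exists_eigenbasis [FiniteDimensional ℂ 𝓗] [CompleteSpace 𝓗] {A : Op 𝓗}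
    (hA : IsSelfAdjoint A) :
    ∃ (b : OrthonormalBasis (Fin (Module.finrank ℂ 𝓗)) ℂ 𝓗)
      (l : Fin (Module.finrank ℂ 𝓗) → ℝ), ∀ i, A (b i) = (l i : ℂ) • b i :=
  ⟨hA.isSymmetric.eigenvectorBasis rfl, hA.isSymmetric.eigenvalues rfl,
    fun i => hA.isSymmetric.apply_eigenvectorBasis rfl i⟩

theorem inner_apply_eq_mul_inner_of_eigenvector [CompleteSpace 𝓗] {A : Op 𝓗}
    (hA : IsSelfAdjoint A) {v : 𝓗} {l : ℝ} (hv : A v = (l : ℂ) • v) (x : 𝓗) :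
    inner ℂ v (A x) = l * inner ℂ v x := by
  have := hA.isSymmetric v x
  simp only [ContinuousLinearMap.coe_coe] at this
  rw [← this, hv, inner_smul_left, Complex.conj_ofReal]

theorem re_inner_apply_self_eq_sum [CompleteSpace 𝓗] {A : Op 𝓗} (hA : IsSelfAdjoint A)
    (b : OrthonormalBasis ι ℂ 𝓗) {l : ι → ℝ} (hb : ∀ i, A (b i) = (l i : ℂ) • b i) (x : 𝓗) :
    (inner ℂ x (A x)).re = ∑ k, l k * ‖inner ℂ (b k) x‖ ^ 2 := by
  rw [← b.sum_inner_mul_inner x (A x), Complex.re_sum]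
  refine Finset.sum_congr rfl fun k _ => ?_
  rw [inner_apply_eq_mul_inner_of_eigenvector hA (hb k), ← inner_conj_symm x (b k),
    mul_left_comm, mul_comm ((starRingEnd ℂ) _), Complex.mul_conj, Complex.normSq_eq_norm_sq,
    ← Complex.ofReal_mul, Complex.ofReal_re]

/-- The squared overlaps of two orthonormal bases are doubly stochastic, which lets sums over
different bases be compared. -/
theorem sum_sum_mul_norm_inner_sq (b : OrthonormalBasis ι ℂ 𝓗) (c : OrthonormalBasis κ ℂ 𝓗)
    (f : ι → ℝ) : ∑ i, ∑ k, f i * ‖inner ℂ (b i) (c k)‖ ^ 2 = ∑ i, f i := by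
  refine Finset.sum_congr rfl fun i _ => ?_
  rw [← Finset.mul_sum, c.sum_sq_norm_inner_left, b.norm_eq_one]
  simp

/-- The trace norm of a self-adjoint operator is the sum of the moduli of its eigenvalues. -/
theorem traceNorm_eq_sum_abs [FiniteDimensional ℂ 𝓗] [CompleteSpace 𝓗] {A : Op 𝓗}
    (hA : IsSelfAdjoint A) (b : OrthonormalBasis ι ℂ 𝓗) {l : ι → ℝ}
    (hb : ∀ i, A (b i) = (l i : ℂ) • b i) : traceNorm A = ∑ i, |l i| := by
  set T : 𝓗 →ₗ[ℂ] 𝓗 := A.toLinearMap with hT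
  have hadj : LinearMap.adjoint T = T := T.isSymmetric_iff_isSelfAdjoint.1 hA.isSymmetric
  set hS := T.isSymmetric_adjoint_comp_self
  set c := hS.eigenvectorBasis rfl with hc
  set ν := hS.eigenvalues rfl with hν
  have hsv : traceNorm A = ∑ i, √(ν i) := by
    rw [traceNorm, Finset.sum_range]
    exact Finset.sum_congr rfl fun i _ => T.singularValues_fin rfl i
  -- Non-orthogonal eigenvectors of `T† T` have equal eigenvalues, so `ν i = l k ^ 2` wherever the
  -- weight is nonzero; no matching of the two spectra is needed.
  have hterm : ∀ i k, √(ν i) * ‖inner ℂ (c i) (b k)‖ ^ 2 = |l k| * ‖inner ℂ (c i) (b k)‖ ^ 2 := by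
    intro i k
    by_cases h0 : inner ℂ (c i) (b k) = 0
    · simp [h0]
    have h1 : inner ℂ (c i) ((LinearMap.adjoint T ∘ₗ T) (b k))
        = (l k : ℂ) ^ 2 * inner ℂ (c i) (b k) := by
      have hTb : T (b k) = (l k : ℂ) • b k := hb k
      rw [LinearMap.comp_apply, hadj, hTb, map_smul, hTb, smul_smul, inner_smul_right, sq]
    have h2 : inner ℂ (c i) ((LinearMap.adjoint T ∘ₗ T) (b k))
        = (ν i : ℂ) * inner ℂ (c i) (b k) := by
      rw [← hS (c i) (b k), hS.apply_eigenvectorBasis rfl i, inner_smul_left]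
      simp [hν, hc]
    have h3 : ν i = l k ^ 2 := by
      have := mul_right_cancel₀ h0 (h2.symm.trans h1)
      exact_mod_cast this
    rw [h3, Real.sqrt_sq_eq_abs]
  rw [hsv, ← sum_sum_mul_norm_inner_sq c b, ← sum_sum_mul_norm_inner_sq b c, Finset.sum_comm]
  refine Finset.sum_congr rfl fun k _ => Finset.sum_congr rfl fun i _ => ?_
  rw [hterm, norm_inner_symm]

/-- The trace norm dominates the weighted diagonals with weights in `[-1, 1]`. -/
theorem weightedDiagonal_le_traceNorm [FiniteDimensional ℂ 𝓗] [CompleteSpace 𝓗] {B : Op 𝓗}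
    (hB : IsSelfAdjoint B) (b : OrthonormalBasis ι ℂ 𝓗) {c : ι → ℝ} (hc : ∀ i, |c i| ≤ 1) :
    weightedDiagonal b c B ≤ traceNorm B := by
  obtain ⟨e, μ, he⟩ := exists_eigenbasis hB
  rw [traceNorm_eq_sum_abs hB e he, weightedDiagonal_apply, ← sum_sum_mul_norm_inner_sq e b,
    Finset.sum_comm]
  refine Finset.sum_le_sum fun i _ => ?_
  rw [re_inner_apply_self_eq_sum hB e he, Finset.mul_sum]
  refine Finset.sum_le_sum fun k _ => ?_
  rw [← mul_assoc]
  gcongr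
  calc c i * μ k ≤ |c i| * |μ k| := (le_abs_self _).trans (abs_mul _ _).le
    _ ≤ 1 * |μ k| := by gcongr; exact hc i
    _ = |μ k| := one_mul _

theorem weightedDiagonal_eq_sum {A : Op 𝓗} (b : OrthonormalBasis ι ℂ 𝓗) {l : ι → ℝ}
    (hb : ∀ i, A (b i) = (l i : ℂ) • b i) (c : ι → ℝ) :
    weightedDiagonal b c A = ∑ i, c i * l i := by
  simp [weightedDiagonal_apply, hb]

theorem weightedDiagonal_le_card_mul_norm (b : OrthonormalBasis ι ℂ 𝓗) {c : ι → ℝ}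
    (hc : ∀ i, |c i| ≤ 1) (B : Op 𝓗) : weightedDiagonal b c B ≤ Fintype.card ι * ‖B‖ := by
  rw [weightedDiagonal_apply, ← nsmul_eq_mul]
  refine Finset.sum_le_card_nsmul _ _ _ fun i _ => ?_
  have h1 : |(inner ℂ (b i) (B (b i))).re| ≤ ‖B‖ := by
    refine (Complex.abs_re_le_norm _).trans ((norm_inner_le_norm _ _).trans ?_)
    simpa [b.norm_eq_one] using B.le_opNorm (b i)
  calc c i * (inner ℂ (b i) (B (b i))).re ≤ |c i| * |(inner ℂ (b i) (B (b i))).re| :=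
        (le_abs_self _).trans (abs_mul _ _).le
    _ ≤ 1 * ‖B‖ := by gcongr; exact hc i
    _ = ‖B‖ := one_mul _

/-- The sign of a real number, with the value `1` at `0`. -/
def signOne (x : ℝ) : ℝ := if 0 ≤ x then 1 else -1

theorem signOne_mul_self (x : ℝ) : signOne x * x = |x| := by
  unfold signOne
  split_ifs with h
  · rw [one_mul, abs_of_nonneg h]
  · rw [neg_one_mul, abs_of_neg (not_le.1 h)]

theorem abs_signOne (x : ℝ) : |signOne x| = 1 := by
  unfold signOne
  split_ifs <;> simp

theorem weightedDiagonal_signOne [FiniteDimensional ℂ 𝓗] [CompleteSpace 𝓗] {A : Op 𝓗}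
    (hA : IsSelfAdjoint A) (b : OrthonormalBasis ι ℂ 𝓗) {l : ι → ℝ}
    (hb : ∀ i, A (b i) = (l i : ℂ) • b i) :
    weightedDiagonal b (fun i => signOne (l i)) A = traceNorm A := by
  rw [weightedDiagonal_eq_sum b hb, traceNorm_eq_sum_abs hA b hb]
  exact Finset.sum_congr rfl fun i _ => signOne_mul_self _

/-- The sign functional of `A` attains the trace norm at `A` and stays below it at `B`. -/
theorem traceNorm_sub_le [FiniteDimensional ℂ 𝓗] [CompleteSpace 𝓗] {A B : Op 𝓗}
    (hA : IsSelfAdjoint A) (hB : IsSelfAdjoint B) :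
    traceNorm A - traceNorm B ≤ Module.finrank ℂ 𝓗 * ‖A - B‖ := by
  obtain ⟨b, l, hb⟩ := exists_eigenbasis hA
  have h1 := weightedDiagonal_le_card_mul_norm b (fun i => (abs_signOne (l i)).le) (A - B)
  have h2 := weightedDiagonal_le_traceNorm hB b fun i => (abs_signOne (l i)).le
  rw [map_sub, weightedDiagonal_signOne hA b hb, Fintype.card_fin] at h1
  linarith

theorem abs_traceNorm_sub_le [FiniteDimensional ℂ 𝓗] [CompleteSpace 𝓗] {A B : Op 𝓗}
    (hA : IsSelfAdjoint A) (hB : IsSelfAdjoint B) :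
    |traceNorm A - traceNorm B| ≤ Module.finrank ℂ 𝓗 * ‖A - B‖ := by
  rw [abs_sub_le_iff]
  exact ⟨traceNorm_sub_le hA hB, by rw [norm_sub_rev]; exact traceNorm_sub_le hB hA⟩

theorem sum_eigenvalues_eq_zero [FiniteDimensional ℂ 𝓗] {A : Op 𝓗}
    (hA : LinearMap.trace ℂ 𝓗 A.toLinearMap = 0) (b : OrthonormalBasis ι ℂ 𝓗) {l : ι → ℝ}
    (hb : ∀ i, A (b i) = (l i : ℂ) • b i) : ∑ i, l i = 0 := by
  rw [LinearMap.trace_eq_sum_inner _ b] at hA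
  simp only [ContinuousLinearMap.coe_coe, hb, inner_smul_right, inner_self_eq_norm_sq_to_K,
    b.norm_eq_one] at hA
  exact_mod_cast (by simpa using hA : (∑ i, (l i : ℂ)) = 0)

end Spectral

/-! ### The generator on the diagonal of an eigenbasis. -/

section Generator

variable {𝓗 : Type*} [NormedAddCommGroup 𝓗] [InnerProductSpace ℂ 𝓗] [CompleteSpace 𝓗]
  {ι : Type*} [Fintype ι]

theorem re_inner_hamiltonianPart_eq_zero (H : Op 𝓗) {A : Op 𝓗} (hA : IsSelfAdjoint A) {v : 𝓗}
    {l : ℝ} (hv : A v = (l : ℂ) • v) : (inner ℂ v (hamiltonianPart H A v)).re = 0 := by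
  simp [-Complex.coe_smul, hamiltonianPart_apply, hv, inner_smul_right, inner_sub_right,
    inner_apply_eq_mul_inner_of_eigenvector hA hv]

/-- The term `L A L†` is the gain into level `i`, and the anticommutator is the loss out of it. -/
theorem re_inner_jumpDissipator (L : Op 𝓗) {A : Op 𝓗} (hA : IsSelfAdjoint A)
    (b : OrthonormalBasis ι ℂ 𝓗) {l : ι → ℝ} (hb : ∀ i, A (b i) = (l i : ℂ) • b i) (i : ι) :
    (inner ℂ (b i) (jumpDissipator L A (b i))).re
      = ∑ k, (l k * ‖inner ℂ (b i) (L (b k))‖ ^ 2 - l i * ‖inner ℂ (b k) (L (b i))‖ ^ 2) := by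
  have h1 : (inner ℂ (b i) (L (A (ContinuousLinearMap.adjoint L (b i))))).re
      = ∑ k, l k * ‖inner ℂ (b i) (L (b k))‖ ^ 2 := by
    rw [← ContinuousLinearMap.adjoint_inner_left, re_inner_apply_self_eq_sum hA b hb]
    refine Finset.sum_congr rfl fun k _ => ?_
    rw [ContinuousLinearMap.adjoint_inner_right, norm_inner_symm]
  have h2 : (inner ℂ (b i) (ContinuousLinearMap.adjoint L (L (b i)))).re
      = ∑ k, ‖inner ℂ (b k) (L (b i))‖ ^ 2 := by
    rw [ContinuousLinearMap.adjoint_inner_right, b.sum_sq_norm_inner_right,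
      inner_self_eq_norm_sq_to_K]
    norm_cast
  rw [Finset.sum_sub_distrib, ← Finset.mul_sum, ← h2, ← h1]
  simp [jumpDissipator_apply, hb,
    inner_apply_eq_mul_inner_of_eigenvector hA (hb i)]
  ring

theorem re_inner_lindbladian {m : ℕ} (H : ℝ → Op 𝓗) (L : Fin m → Op 𝓗) (t : ℝ) {A : Op 𝓗}
    (hA : IsSelfAdjoint A) (b : OrthonormalBasis ι ℂ 𝓗) {l : ι → ℝ}
    (hb : ∀ i, A (b i) = (l i : ℂ) • b i) (i : ι) :
    (inner ℂ (b i) (lindbladian H L t A (b i))).re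
      = ∑ k, (l k * ∑ j, ‖inner ℂ (b i) (L j (b k))‖ ^ 2
          - l i * ∑ j, ‖inner ℂ (b k) (L j (b i))‖ ^ 2) := by
  simp only [lindbladian, dissipator, add_apply, inner_add_right,
    sum_apply, inner_sum, Complex.add_re, Complex.re_sum,
    re_inner_hamiltonianPart_eq_zero _ hA (hb i), re_inner_jumpDissipator _ hA b hb, zero_add]
  rw [Finset.sum_comm]
  simp only [Finset.sum_sub_distrib, Finset.mul_sum]

end Generator

/-! ### Total variation under a classical rate equation. -/

section RealInequalities

variable {ι : Type*} [Fintype ι]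

/-- Summation by parts: each jump from `i` to `k` contributes through the change of sign it causes.
-/
theorem sum_mul_sum_flux_eq (s l : ι → ℝ) (w : ι → ι → ℝ) :
    ∑ i, s i * ∑ k, (l k * w i k - l i * w k i) = ∑ i, ∑ k, l i * w k i * (s k - s i) := by
  have h : ∑ i, ∑ k, s i * (l k * w i k) = ∑ i, ∑ k, s k * (l i * w k i) := Finset.sum_comm
  simp only [Finset.mul_sum, mul_sub, Finset.sum_sub_distrib, h]
  congr 1 <;>
  exact Finset.sum_congr rfl fun i _ => Finset.sum_congr rfl fun k _ => by ring

theorem mul_signOne_sub_nonpos (x y : ℝ) : x * (signOne y - signOne x) ≤ 0 := by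
  unfold signOne
  split_ifs <;> nlinarith

/-- A lower bound on the off-diagonal rates gives a decay estimate of the total variation. -/
theorem flux_le_of_le {l : ι → ℝ} {w : ι → ι → ℝ} {r : ℝ} (hl : ∑ i, l i = 0)
    (hw : ∀ i k, i ≠ k → r ≤ w k i) :
    ∑ i, signOne (l i) * ∑ k, (l k * w i k - l i * w k i)
      ≤ -(Fintype.card ι * r) * ∑ i, |l i| := by
  rw [sum_mul_sum_flux_eq]
  calc ∑ i, ∑ k, l i * w k i * (signOne (l k) - signOne (l i))
      ≤ ∑ i, ∑ k, r * (l i * signOne (l k) - signOne (l i) * l i) := by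
        -- Each rate multiplies a nonpositive factor, so lowering it to `r` increases the sum; the
        -- diagonal terms vanish on both sides.
        refine Finset.sum_le_sum fun i _ => Finset.sum_le_sum fun k _ => ?_
        by_cases hik : i = k
        · subst hik
          simp [mul_comm]
        · nlinarith [mul_signOne_sub_nonpos (l i) (l k), hw i k hik]
    _ = -(Fintype.card ι * r) * ∑ i, |l i| := by
        simp only [signOne_mul_self, mul_sub, Finset.sum_sub_distrib, ← Finset.mul_sum,
          ← Finset.sum_mul, hl, Finset.sum_const, Finset.card_univ, nsmul_eq_mul]
        ring

/-- A lower bound on the symmetrized off-diagonal rates gives a decay estimate of the total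
variation. -/
theorem flux_le_of_le_add {l : ι → ℝ} {w : ι → ι → ℝ} {R : ℝ} (hl : ∑ i, l i = 0)
    (hw0 : ∀ i k, 0 ≤ w i k) (hw : ∀ i k, i ≠ k → R ≤ w k i + w i k) :
    ∑ i, signOne (l i) * ∑ k, (l k * w i k - l i * w k i) ≤ -R * ∑ i, |l i| := by
  classical
  rw [sum_mul_sum_flux_eq]
  set N := ∑ i, |l i| with hN
  have hN0 : 0 ≤ N := Finset.sum_nonneg fun _ _ => abs_nonneg _
  rcases hN0.eq_or_lt with h0 | hpos
  · have hz : ∀ i, l i = 0 := fun i =>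
      abs_eq_zero.1 ((Finset.sum_eq_zero_iff_of_nonneg fun _ _ => abs_nonneg _).1
        (hN.symm.trans h0.symm) i (Finset.mem_univ i))
    simp [hz, ← h0]
  -- As `l` sums to zero, `|l k|` is at most the sum of the other moduli.
  have hhalf : ∀ k, 2 * |l k| ≤ N := by
    intro k
    have h1 := Finset.add_sum_erase Finset.univ (fun i => |l i|) (Finset.mem_univ k)
    have h2 := Finset.add_sum_erase Finset.univ l (Finset.mem_univ k)
    have h3 := Finset.abs_sum_le_sum_abs l (Finset.univ.erase k)
    have h4 : |l k| = |∑ i ∈ Finset.univ.erase k, l i| := by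
      rw [← abs_neg]; congr 1; linarith
    linarith
  -- The weight `q` is symmetric, zero for equal signs and `2 |l i| |l k|` for opposite ones. Its
  -- total is `N ^ 2`, because `l` sums to zero.
  set q : ι → ι → ℝ := fun i k => |l i| * |l k| - l i * l k with hq
  have hq0 : ∀ i k, 0 ≤ q i k := fun i k => by
    simp only [hq, ← abs_mul]; linarith [le_abs_self (l i * l k)]
  have hterm : ∀ i k, N * (l i * w k i * (signOne (l k) - signOne (l i))) ≤ -2 * (q i k * w k i) := by
    intro i k
    -- For strictly opposite signs the left side is `-2 N |l i|`, and `N ≥ 2 |l k|` by `hhalf`.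
    have key : N * (l i * (signOne (l k) - signOne (l i))) ≤ -2 * q i k := by
      have hk := hhalf k
      have hl1 := signOne_mul_self (l i)
      simp only [hq]
      unfold signOne
      rcases le_or_gt 0 (l i) with hi | hi <;> rcases le_or_gt 0 (l k) with hk' | hk'
      · rw [abs_of_nonneg hi, abs_of_nonneg hk', if_pos hi, if_pos hk']; linarith
      · rw [abs_of_neg hk'] at hk ⊢
        rw [abs_of_nonneg hi, if_pos hi, if_neg (not_le.2 hk')]
        nlinarith
      · rw [abs_of_nonneg hk'] at hk ⊢
        rw [abs_of_neg hi, if_pos hk', if_neg (not_le.2 hi)]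
        nlinarith
      · rw [abs_of_neg hi, abs_of_neg hk', if_neg (not_le.2 hi), if_neg (not_le.2 hk')]; linarith
    nlinarith [mul_le_mul_of_nonneg_right key (hw0 k i)]
  have hsym : ∑ i, ∑ k, q i k * w k i = ∑ i, ∑ k, q i k * w i k := by
    rw [Finset.sum_comm]
    refine Finset.sum_congr rfl fun i _ => Finset.sum_congr rfl fun k _ => ?_
    simp only [hq]; ring
  have hqsum : ∑ i, ∑ k, q i k = N * N := by
    simp only [hq, Finset.sum_sub_distrib, ← Finset.mul_sum, ← Finset.sum_mul, hl, ← hN]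
    ring
  -- By the symmetry of `q` both directions of a pair carry the same weight, so only the sum `w k i
  -- + w i k` matters.
  have hR : R * (N * N) ≤ ∑ i, ∑ k, q i k * w k i + ∑ i, ∑ k, q i k * w i k := by
    rw [← hqsum, Finset.mul_sum, ← Finset.sum_add_distrib]
    refine Finset.sum_le_sum fun i _ => ?_
    rw [Finset.mul_sum, ← Finset.sum_add_distrib]
    refine Finset.sum_le_sum fun k _ => ?_
    by_cases hik : i = k
    · subst hik
      simp [hq]
    · nlinarith [hq0 i k, hw i k hik]
  have hle : N * ∑ i, ∑ k, l i * w k i * (signOne (l k) - signOne (l i))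
      ≤ -2 * ∑ i, ∑ k, q i k * w k i := by
    simp only [Finset.mul_sum]
    exact Finset.sum_le_sum fun i _ => Finset.sum_le_sum fun k _ => hterm i k
  refine le_of_mul_le_mul_left ?_ hpos
  linarith

end RealInequalities

end DrivenLindblad

end

/-! ### From the generator inequality to contraction of the evolution. -/

noncomputable section

open MeasureTheory Set

namespace DrivenLindblad

variable {𝓗 : Type*} [NormedAddCommGroup 𝓗] [InnerProductSpace ℂ 𝓗]

theorem intervalIntegrable_lindbladian [CompleteSpace 𝓗] {m : ℕ} {H : ℝ → Op 𝓗} (hH : IsDrive H)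
    (L : Fin m → Op 𝓗) {s T : ℝ} (hs : 0 ≤ s) (hsT : s ≤ T) :
    IntervalIntegrable (lindbladian H L) volume s T := by
  have hint : IntervalIntegrable H volume s T := by
    refine (hH.2.integrableOn_compact_subset ?_ isCompact_uIcc).intervalIntegrable
    rw [uIcc_of_le hsT]
    exact fun x hx => hs.trans hx.1
  -- `hamiltonianPart` as a bounded linear map of the Hamiltonian, so that integrability passes
  -- through it.
  let P : Op 𝓗 →L[ℂ] SuperOp 𝓗 :=
    (-Complex.I) • ((ContinuousLinearMap.mulLeftRight ℂ (Op 𝓗)).flip 1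
      - ContinuousLinearMap.mulLeftRight ℂ (Op 𝓗) 1)
  have hP : IntervalIntegrable (fun τ => P (H τ)) volume s T :=
    ⟨P.integrable_comp hint.1, P.integrable_comp hint.2⟩
  exact hP.add (intervalIntegrable_const (c := dissipator L))

theorem isSelfAdjoint_lindbladian [CompleteSpace 𝓗] {m : ℕ} {H : ℝ → Op 𝓗} {t : ℝ}
    (hH : IsSelfAdjoint (H t)) (L : Fin m → Op 𝓗) {A : Op 𝓗} (hA : IsSelfAdjoint A) :
    IsSelfAdjoint (lindbladian H L t A) := by
  have h1 : IsSelfAdjoint (hamiltonianPart (H t) A) := by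
    rw [isSelfAdjoint_iff, hamiltonianPart_apply, star_smul, star_sub, star_mul, star_mul,
      hH.star_eq, hA.star_eq]
    simp only [star_neg, Complex.star_def, Complex.conj_I, neg_neg, neg_smul, smul_sub]
    abel
  have h2 : ∀ j, IsSelfAdjoint (jumpDissipator (L j) A) := by
    intro j
    rw [isSelfAdjoint_iff, jumpDissipator_apply, ← ContinuousLinearMap.star_eq_adjoint]
    simp only [star_sub, star_smul, star_add, star_mul, star_star, hA.star_eq, mul_assoc]
    simp [add_comm]
  rw [lindbladian, dissipator, add_apply, sum_apply]
  exact h1.add (isSelfAdjoint_sum _ fun j _ => h2 j)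

/-- The trace, as a real linear functional on the operators. -/
def traceCLM (𝓗 : Type*) [NormedAddCommGroup 𝓗] [InnerProductSpace ℂ 𝓗] [FiniteDimensional ℂ 𝓗] :
    Op 𝓗 →L[ℝ] ℂ :=
  (LinearMap.toContinuousLinearMap
    (LinearMap.trace ℂ 𝓗 ∘ₗ ContinuousLinearMap.coeLM ℂ)).restrictScalars ℝ

theorem traceCLM_apply [FiniteDimensional ℂ 𝓗] (A : Op 𝓗) :
    traceCLM 𝓗 A = LinearMap.trace ℂ 𝓗 A.toLinearMap := rfl

theorem trace_mul_comm [FiniteDimensional ℂ 𝓗] (A B : Op 𝓗) :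
    LinearMap.trace ℂ 𝓗 (A * B).toLinearMap = LinearMap.trace ℂ 𝓗 (B * A).toLinearMap :=
  LinearMap.trace_mul_comm ℂ A.toLinearMap B.toLinearMap

theorem trace_lindbladian [FiniteDimensional ℂ 𝓗] [CompleteSpace 𝓗] {m : ℕ} (H : ℝ → Op 𝓗)
    (L : Fin m → Op 𝓗) (t : ℝ) (A : Op 𝓗) :
    LinearMap.trace ℂ 𝓗 (lindbladian H L t A).toLinearMap = 0 := by
  have h1 : LinearMap.trace ℂ 𝓗 (hamiltonianPart (H t) A).toLinearMap = 0 := by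
    rw [hamiltonianPart_apply, ContinuousLinearMap.toLinearMap_smul, map_smul,
      ContinuousLinearMap.toLinearMap_sub, map_sub, trace_mul_comm, sub_self, smul_zero]
  have h2 : ∀ j, LinearMap.trace ℂ 𝓗 (jumpDissipator (L j) A).toLinearMap = 0 := by
    intro j
    rw [jumpDissipator_apply, ContinuousLinearMap.toLinearMap_sub, map_sub,
      ContinuousLinearMap.toLinearMap_smul, map_smul, ContinuousLinearMap.toLinearMap_add, map_add,
      trace_mul_comm A, trace_mul_comm (L j * A), ← mul_assoc, ← two_smul ℂ, smul_smul]
    norm_num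
  rw [lindbladian, dissipator, add_apply, sum_apply, ContinuousLinearMap.toLinearMap_add, map_add,
    h1, ContinuousLinearMap.toLinearMap_sum, map_sum, Finset.sum_eq_zero fun j _ => h2 j, add_zero]

/-- If the generator points inwards, at rate `γ`, along the supporting functional of the trace norm
at every traceless self-adjoint operator, then the evolution contracts with constants `(1, γ)`. -/
theorem contractsWith_of_weightedDiagonal_le [FiniteDimensional ℂ 𝓗] [CompleteSpace 𝓗] {m : ℕ}
    {H : ℝ → Op 𝓗} (hH : IsDrive H) (L : Fin m → Op 𝓗) {γ : ℝ}
    (hγ : ∀ t, ∀ A : Op 𝓗, IsSelfAdjoint A → LinearMap.trace ℂ 𝓗 A.toLinearMap = 0 →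
      ∀ (b : OrthonormalBasis (Fin (Module.finrank ℂ 𝓗)) ℂ 𝓗)
        (l : Fin (Module.finrank ℂ 𝓗) → ℝ), (∀ i, A (b i) = (l i : ℂ) • b i) →
        weightedDiagonal b (fun i => signOne (l i)) (lindbladian H L t A) ≤ -γ * traceNorm A) :
    ContractsWith (lindbladian H L) 1 γ := by
  intro ρ hρ σ hσ s T hs hsT
  set 𝓛 := lindbladian H L
  set X : ℝ → Op 𝓗 := fun τ => evolution 𝓛 τ s (ρ - σ) with hX
  set V : ℝ → Op 𝓗 := fun τ => 𝓛 τ (X τ) with hV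
  have h𝓛 : ∀ τ, s ≤ τ → IntervalIntegrable 𝓛 volume s τ := fun τ hτ =>
    intervalIntegrable_lindbladian hH L hs hτ
  have hVint : IntervalIntegrable V volume s T :=
    intervalIntegrable_evolution_apply hsT (h𝓛 T hsT) _
  have hXeq : ∀ τ ∈ uIcc s T, X τ = (ρ - σ) + ∫ v in s..τ, V v := by
    intro τ hτ
    rw [uIcc_of_le hsT] at hτ
    exact evolution_apply_eq hτ.1 (h𝓛 τ hτ.1) _
  have hsa : ∀ τ ∈ uIcc s T, IsSelfAdjoint (X τ) := by
    intro τ hτ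
    rw [uIcc_of_le hsT] at hτ
    -- The adjoint is only real linear, hence the real functionals in `map_evolution_eq_zero`.
    let ℓ : Op 𝓗 →L[ℝ] Op 𝓗 :=
      (starL' ℝ : Op 𝓗 ≃L[ℝ] Op 𝓗).toContinuousLinearMap - ContinuousLinearMap.id ℝ (Op 𝓗)
    have hℓ : ∀ A : Op 𝓗, ℓ A = 0 ↔ IsSelfAdjoint A := fun A => sub_eq_zero
    refine (hℓ _).1 (map_evolution_eq_zero ℓ hτ.1 (h𝓛 τ hτ.1) ?_ ?_)
    · intro v hv A hA
      exact (hℓ _).2 (isSelfAdjoint_lindbladian (hH.1 v (hs.trans hv.1)) L ((hℓ _).1 hA))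
    · exact (hℓ _).2 (hρ.1.isSelfAdjoint.sub hσ.1.isSelfAdjoint)
  have htr : ∀ τ ∈ uIcc s T, LinearMap.trace ℂ 𝓗 (X τ).toLinearMap = 0 := by
    intro τ hτ
    rw [uIcc_of_le hsT] at hτ
    refine map_evolution_eq_zero (traceCLM 𝓗) hτ.1 (h𝓛 τ hτ.1) ?_ ?_
    · exact fun v _ A _ => trace_lindbladian H L v A
    · rw [map_sub, traceCLM_apply, traceCLM_apply, hρ.2, hσ.2, sub_self]
  set f : ℝ → ℝ := fun τ => traceNorm (X τ) with hf
  have hfac : AbsolutelyContinuousOnInterval f s T := by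
    refine ((hVint.norm.absolutelyContinuousOnInterval_intervalIntegral
      (c := s) left_mem_uIcc).const_mul (Module.finrank ℂ 𝓗 : ℝ)).of_dist_le ?_
    intro x hx y hy
    have hsx := hVint.mono_set (uIcc_subset_uIcc left_mem_uIcc hx)
    have hsy := hVint.mono_set (uIcc_subset_uIcc left_mem_uIcc hy)
    rw [Real.dist_eq, Real.dist_eq, ← mul_sub, abs_mul, Nat.abs_cast,
      intervalIntegral.integral_interval_sub_left hsx.norm hsy.norm]
    refine (abs_traceNorm_sub_le (hsa x hx) (hsa y hy)).trans ?_
    gcongr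
    rw [hXeq x hx, hXeq y hy, add_sub_add_left_eq_sub,
      intervalIntegral.integral_interval_sub_left hsx hsy]
    exact intervalIntegral.norm_integral_le_abs_integral_norm
  have hderiv : ∀ᵐ τ, τ ∈ uIcc s T → DifferentiableAt ℝ f τ ∧ deriv f τ ≤ -γ * f τ := by
    -- The endpoints are discarded: a two-sided derivative needs a neighbourhood inside the
    -- interval.
    have hs' : ∀ᵐ τ : ℝ, τ ≠ s := by simp [ae_iff, measure_singleton]
    have hT' : ∀ᵐ τ : ℝ, τ ≠ T := by simp [ae_iff, measure_singleton]
    filter_upwards [hfac.ae_differentiableAt, hVint.ae_hasDerivAt_integral, hs', hT']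
      with τ hdiff hprim hτs hτT hτ
    refine ⟨hdiff hτ, ?_⟩
    have hnhds : uIcc s T ∈ nhds τ := by
      rw [uIcc_of_le hsT] at hτ ⊢
      exact Icc_mem_nhds (lt_of_le_of_ne hτ.1 hτs.symm) (lt_of_le_of_ne hτ.2 hτT)
    have hXd : HasDerivAt X (V τ) τ :=
      ((hprim hτ s left_mem_uIcc).const_add (ρ - σ)).congr_of_eventuallyEq
        (Filter.eventually_of_mem hnhds hXeq)
    obtain ⟨b, l, hb⟩ := exists_eigenbasis (hsa τ hτ)
    set φ := weightedDiagonal b fun i => signOne (l i)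
    have hφd : HasDerivAt (fun v => φ (X v)) (φ (V τ)) τ := φ.hasFDerivAt.comp_hasDerivAt τ hXd
    -- The functional `φ`, frozen at time `τ`, touches `f` from below there, so `f` and `φ ∘ X` have
    -- the same derivative at `τ`.
    have hmin : IsLocalMin (fun v => f v - φ (X v)) τ := by
      refine Filter.eventually_of_mem hnhds fun v hv => ?_
      have h1 : φ (X τ) = f τ := weightedDiagonal_signOne (hsa τ hτ) b hb
      have h2 : φ (X v) ≤ f v :=
        weightedDiagonal_le_traceNorm (hsa v hv) b fun i => (abs_signOne (l i)).le
      linarith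
    have h0 := hmin.hasDerivAt_eq_zero ((hdiff hτ).hasDerivAt.sub hφd)
    rw [sub_eq_zero.1 h0]
    exact hγ τ (X τ) (hsa τ hτ) (htr τ hτ) b l hb
  have hexp : AbsolutelyContinuousOnInterval (fun τ => Real.exp (γ * τ)) s T :=
    ContDiffOn.absolutelyContinuousOnInterval (by fun_prop)
  have hFTC := (hexp.fun_mul hfac).integral_deriv_eq_sub
  -- Grönwall: `exp (γ τ) f τ` has derivative `exp (γ τ) (γ f + f') ≤ 0` almost everywhere.
  have hnonpos : 0 ≤ ∫ τ in s..T, -deriv (fun τ => Real.exp (γ * τ) * f τ) τ := by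
    refine intervalIntegral.integral_nonneg_of_ae_restrict hsT
      ((ae_restrict_iff' measurableSet_Icc).2 ?_)
    filter_upwards [hderiv] with τ hτ hmem
    obtain ⟨hd, hle⟩ := hτ (Icc_subset_uIcc hmem)
    have he : HasDerivAt (fun τ => Real.exp (γ * τ)) (Real.exp (γ * τ) * γ) τ := by
      simpa using ((hasDerivAt_id τ).const_mul γ).exp
    rw [Pi.zero_apply, (he.fun_mul hd.hasDerivAt).deriv]
    nlinarith [Real.exp_pos (γ * τ)]
  rw [intervalIntegral.integral_neg, hFTC] at hnonpos
  have hfs : f s = traceNorm (ρ - σ) := by simp [hf, hX, evolution_self]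
  rw [abs_of_nonneg (sub_nonneg.2 hsT), one_mul, ← hfs]
  have hsplit : Real.exp (-γ * (T - s)) = Real.exp (γ * s) / Real.exp (γ * T) := by
    rw [← Real.exp_sub]; ring_nf
  rw [hsplit, div_mul_eq_mul_div, le_div_iff₀ (Real.exp_pos _)]
  linarith

/-! ### Compactness of the orthonormal pairs. -/

section Minima

variable [FiniteDimensional ℂ 𝓗]

/-- A continuous function of orthonormal pairs attains its infimum. -/
theorem isLeast_sInf_orthonormal_pairs (hd : 2 ≤ Module.finrank ℂ 𝓗) {F : 𝓗 × 𝓗 → ℝ}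
    (hF : Continuous F) :
    IsLeast {x | ∃ u v : 𝓗, ‖u‖ = 1 ∧ ‖v‖ = 1 ∧ inner ℂ u v = 0 ∧ x = F (u, v)}
      (sInf {x | ∃ u v : 𝓗, ‖u‖ = 1 ∧ ‖v‖ = 1 ∧ inner ℂ u v = 0 ∧ x = F (u, v)}) := by
  have : ProperSpace 𝓗 := FiniteDimensional.proper ℂ 𝓗
  set S : Set (𝓗 × 𝓗) :=
    (Metric.sphere 0 1 ×ˢ Metric.sphere 0 1) ∩ {p | inner ℂ p.1 p.2 = 0} with hS
  have hcomp : IsCompact S :=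
    ((isCompact_sphere 0 1).prod (isCompact_sphere 0 1)).inter_right
      (isClosed_eq (by fun_prop) continuous_const)
  have himg : {x | ∃ u v : 𝓗, ‖u‖ = 1 ∧ ‖v‖ = 1 ∧ inner ℂ u v = 0 ∧ x = F (u, v)} = F '' S := by
    ext x
    constructor
    · rintro ⟨u, v, hu, hv, huv, rfl⟩
      exact ⟨(u, v), by simp [hS, hu, hv, huv], rfl⟩
    · rintro ⟨⟨u, v⟩, h, rfl⟩
      simp only [hS, mem_inter_iff, mem_prod, mem_sphere_zero_iff_norm, mem_ofPred_eq] at h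
      exact ⟨u, v, h.1.1, h.1.2, h.2, rfl⟩
  rw [himg]
  refine (hcomp.image hF).isLeast_sInf (Nonempty.image F ?_)
  let b := stdOrthonormalBasis ℂ 𝓗
  let i : Fin (Module.finrank ℂ 𝓗) := ⟨0, by omega⟩
  let k : Fin (Module.finrank ℂ 𝓗) := ⟨1, by omega⟩
  have hik : i ≠ k := by simp [i, k]
  exact ⟨(b i, b k), by simp [hS, b.inner_eq_zero hik]⟩

theorem isLeast_bigR [CompleteSpace 𝓗] (hd : 2 ≤ Module.finrank ℂ 𝓗) {m : ℕ} (L : Fin m → Op 𝓗) :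
    IsLeast (bigRValues L) (bigR L) :=
  isLeast_sInf_orthonormal_pairs hd (F := fun p => ∑ j, (‖inner ℂ p.2 (L j p.1)‖ ^ 2
    + ‖inner ℂ p.2 (ContinuousLinearMap.adjoint (L j) p.1)‖ ^ 2)) (by fun_prop)

theorem isLeast_smallR (hd : 2 ≤ Module.finrank ℂ 𝓗) {m : ℕ} (L : Fin m → Op 𝓗) :
    IsLeast (smallRValues L) (smallR L) :=
  isLeast_sInf_orthonormal_pairs hd (F := fun p => ∑ j, ‖inner ℂ p.2 (L j p.1)‖ ^ 2)
    (by fun_prop)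

end Minima

/-! ### The two contraction estimates. -/

section Contraction

variable [FiniteDimensional ℂ 𝓗] [CompleteSpace 𝓗] {m : ℕ} {H : ℝ → Op 𝓗}

/-- The adjoint terms in `bigR` are the reversed rates, so it bounds exactly the symmetrized rates
of `flux_le_of_le_add`. -/
theorem contractsWith_bigR (hd : 2 ≤ Module.finrank ℂ 𝓗) (hH : IsDrive H) (L : Fin m → Op 𝓗) :
    ContractsWith (lindbladian H L) 1 (bigR L) := by
  refine contractsWith_of_weightedDiagonal_le hH L fun t A hA htr b l hb => ?_
  rw [weightedDiagonal_apply, traceNorm_eq_sum_abs hA b hb]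
  simp only [re_inner_lindbladian H L t hA b hb]
  refine flux_le_of_le_add (sum_eigenvalues_eq_zero htr b hb)
    (w := fun i k => ∑ j, ‖inner ℂ (b i) (L j (b k))‖ ^ 2) (fun i k => by positivity)
    fun i k hik => (isLeast_bigR hd L).2
      ⟨b i, b k, b.norm_eq_one i, b.norm_eq_one k, b.inner_eq_zero hik, ?_⟩
  rw [← Finset.sum_add_distrib]
  refine Finset.sum_congr rfl fun j _ => ?_
  rw [ContinuousLinearMap.adjoint_inner_right, norm_inner_symm (L j (b k))]

theorem contractsWith_smallR (hd : 2 ≤ Module.finrank ℂ 𝓗) (hH : IsDrive H) (L : Fin m → Op 𝓗) :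
    ContractsWith (lindbladian H L) 1 (Module.finrank ℂ 𝓗 * smallR L) := by
  refine contractsWith_of_weightedDiagonal_le hH L fun t A hA htr b l hb => ?_
  rw [weightedDiagonal_apply, traceNorm_eq_sum_abs hA b hb]
  simp only [re_inner_lindbladian H L t hA b hb]
  have := flux_le_of_le (sum_eigenvalues_eq_zero htr b hb)
    (w := fun i k => ∑ j, ‖inner ℂ (b i) (L j (b k))‖ ^ 2)
    fun i k hik => (isLeast_smallR hd L).2
      ⟨b i, b k, b.norm_eq_one i, b.norm_eq_one k, b.inner_eq_zero hik, rfl⟩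
  rwa [Fintype.card_fin] at this

end Contraction

theorem le_contractionRate [FiniteDimensional ℂ 𝓗] {𝓛 : ℝ → SuperOp 𝓗} {γ : ℝ} (hγ : 0 < γ)
    (h : ContractsWith 𝓛 1 γ) : (γ : EReal) ≤ contractionRate 𝓛 :=
  le_sSup ⟨1, γ, one_pos, hγ, h, rfl⟩

end DrivenLindblad

end

/-- The infima defining `R` and `r` are minima; if `R > 0`, every drive gives contraction at rate
at least `R`, with `K = 1`; if `r > 0`, the same holds with `dim 𝓗 * r` in place of `R`. -/
theorem mainTheorem4 {𝓗 : Type*} [NormedAddCommGroup 𝓗] [InnerProductSpace ℂ 𝓗]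
    [FiniteDimensional ℂ 𝓗] [CompleteSpace 𝓗] (hd : 2 ≤ Module.finrank ℂ 𝓗)
    {m : ℕ} (L : Fin m → Op 𝓗) :
    IsLeast (bigRValues L) (bigR L) ∧
    IsLeast (smallRValues L) (smallR L) ∧
    (0 < bigR L →
      IsHamiltonianIndependentlyContractive L ∧
      ∀ H : ℝ → Op 𝓗, IsDrive H →
        (bigR L : EReal) ≤ contractionRate (lindbladian H L) ∧
        ContractsWith (lindbladian H L) 1 (bigR L)) ∧
    (0 < smallR L →
      IsHamiltonianIndependentlyContractive L ∧
      ∀ H : ℝ → Op 𝓗, IsDrive H →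
        ((Module.finrank ℂ 𝓗 * smallR L : ℝ) : EReal) ≤ contractionRate (lindbladian H L) ∧
        ContractsWith (lindbladian H L) 1 (Module.finrank ℂ 𝓗 * smallR L)) := by
  have hsmall : 0 < smallR L → 0 < (Module.finrank ℂ 𝓗 : ℝ) * smallR L := fun h =>
    mul_pos (Nat.cast_pos.2 (by omega)) h
  refine ⟨isLeast_bigR hd L, isLeast_smallR hd L, fun h => ⟨fun H hH => ?_, fun H hH => ?_⟩,
    fun h => ⟨fun H hH => ?_, fun H hH => ?_⟩⟩
  · exact ⟨1, _, one_pos, h, contractsWith_bigR hd hH L⟩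
  · exact ⟨le_contractionRate h (contractsWith_bigR hd hH L), contractsWith_bigR hd hH L⟩
  · exact ⟨1, _, one_pos, hsmall h, contractsWith_smallR hd hH L⟩
  · exact ⟨le_contractionRate (hsmall h) (contractsWith_smallR hd hH L),
      contractsWith_smallR hd hH L⟩
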